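/- Consider an asynchronous message-passing system of $n\ge 2$ processes $p_1,\dots,p_n$ running a deterministic protocol: in each step a process receives at most one of the messages in transit to it, changes its local state, and sends finitely many messages to processes (possibly itself); decisions are irrevocable. At most $f$ processes may crash (stop taking steps for ever); every message sent to a correct (non-crashed) process is eventually received, but message delays and relative process speeds are unbounded. A *lattice* is a join semilattice $(X,\le,\sqcup)$. A *quasi-metric* over $X$ is a function $\delta_X:X\times X\to[0,\infty]\cup\{\bot\}$ such that for all $a,b,c\in X$: $a=b\Leftrightarrow\delta_X(a,b)=0$; $a\le b\Leftrightarrow\delta_X(a,b)\ne\bot$; and $a\le b\le c$ implies $\delta_X(a,c)\le\delta_X(a,b)+\delta_X(b,c)$. For a real $\varepsilon\ge 0$, a protocol *solves $\varepsilon$-bounded lattice agreement over $(X,\delta_X)$ with at most $f$ faults* if for all inputs $x_1,\dots,x_n\in X$ and in every run with at most $f$ crashes, each correct process $p_i$ decides on some $y_i\in X$ such that for all correct $p_i,p_j$: $x_i\le y_i$; $y_i\le\bigsqcup_{k=1}^n x_k$; $y_i\le y_j$ or $y_j\le y_i$; and $y_i\le y_j$ implies $\delta_X(y_i,y_j)\le\varepsilon$.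 **Theorem.** Let $n\ge 2$, $f\ge 1$ and $\varepsilon\ge 0$. Then there is no asynchronous protocol (even one that may depend on the lattice, the quasi-metric, $n$, $f$ and $\varepsilon$) that solves $\varepsilon$-bounded lattice agreement with at most $f$ faults over all lattices and quasi-metrics. Moreover, there are a finite lattice $X$, a quasi-metric $\delta_X$ and inputs $x_1,\dots,x_n\in X$, not all equal, such that $\delta_X(a,b)>\varepsilon$ for all $a<b$ in the join-closed sub-semilattice generated by $x_1,\dots,x_n$, and no asynchronous protocol solves $\varepsilon$-bounded lattice agreement over $(X,\delta_X)$ with at most $f$ faults. -/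

import Mathlib

open scoped NNReal ENNReal

universe u v w

/-- A quasi-metric over a join semilattice `X`, with values in `[0, ∞] ∪ {⊥}`;
`⊥` marks the pairs `(a, b)` with `¬ a ≤ b`. -/
structure QuasiMetric (X : Type w) [SemilatticeSup X] where
  dist : X → X → WithBot ℝ≥0∞
  eq_iff : ∀ a b, a = b ↔ dist a b = 0
  le_iff : ∀ a b, a ≤ b ↔ dist a b ≠ ⊥
  triangle : ∀ a b c, a ≤ b → b ≤ c → dist a c ≤ dist a b + dist b c

/-- The real number `ε ≥ 0` as a possible value of a quasi-metric. -/
def boundValue (ε : ℝ≥0) : WithBot ℝ≥0∞ := ((ε : ℝ≥0∞) : WithBot ℝ≥0∞)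

/-- The requirements of `ε`-bounded lattice agreement on inputs `x` and outputs `y`, imposed on
the outputs of the processes in `C` (the correct ones). The join in `upward` is over the inputs of
all `n` processes. -/
structure IsBoundedLatticeAgreement {n : ℕ} {X : Type w} [SemilatticeSup X] (δ : QuasiMetric X)
    (ε : ℝ≥0) (C : Set (Fin n)) (x y : Fin n → X) : Prop where
  downward : ∀ i ∈ C, x i ≤ y i
  upward : ∀ i ∈ C, y i ≤ Finset.univ.sup' ⟨i, Finset.mem_univ i⟩ x
  comparable : ∀ i ∈ C, ∀ j ∈ C, y i ≤ y j ∨ y j ≤ y i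
  tight : ∀ i ∈ C, ∀ j ∈ C, y i ≤ y j → δ.dist (y i) (y j) ≤ boundValue ε

/-- A deterministic asynchronous message-passing protocol for `n` processes with inputs and
outputs in `X`. In one step a process receives at most one message (`none`: no message is
received), changes its state and sends finitely many messages, each to some process, possibly
itself. Decisions are irrevocable. -/
structure Protocol (n : ℕ) (X : Type w) where
  State : Type u
  Msg : Type v
  init : Fin n → X → State
  step : Fin n → State → Option Msg → State × Multiset (Fin n × Msg)
  decision : State → Option X
  decision_stable : ∀ i s m y, decision s = some y → decision (step i s m).1 = some y

namespace Protocol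

variable {n : ℕ} {X : Type w}

/-- A global configuration: the local states, and the messages in transit, each with its
destination. -/
structure Config (P : Protocol.{u, v} n X) where
  state : Fin n → P.State
  buffer : Multiset (Fin n × P.Msg)

/-- The messages consumed when process `i` receives `m`. -/
def consumed (P : Protocol.{u, v} n X) (i : Fin n) : Option P.Msg → Multiset (Fin n × P.Msg)
  | none => 0
  | some m => {(i, m)}

/-- Process `i` takes a step from `c` to `c'` in which it receives `m`. -/
def Step (P : Protocol.{u, v} n X) (c : P.Config) (i : Fin n) (m : Option P.Msg)
    (c' : P.Config) : Prop :=
  c'.state = Function.update c.state i (P.step i (c.state i) m).1 ∧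
    ∃ rest, c.buffer = P.consumed i m + rest ∧
      c'.buffer = rest + (P.step i (c.state i) m).2

/-- An infinite run of the protocol on the inputs `x`: at time `t` process `proc t` takes a step
in which it receives `recv t`. -/
structure Run (P : Protocol.{u, v} n X) (x : Fin n → X) where
  config : ℕ → P.Config
  proc : ℕ → Fin n
  recv : ℕ → Option P.Msg
  init_state : ∀ i, (config 0).state i = P.init i (x i)
  init_buffer : (config 0).buffer = 0
  step : ∀ t, P.Step (config t) (proc t) (recv t) (config (t + 1))

namespace Run

variable {P : Protocol.{u, v} n X} {x : Fin n → X}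

/-- The correct processes take infinitely many steps; the others crash, that is, take no step
from some time on. -/
def correct (ρ : P.Run x) : Set (Fin n) := {i | ∀ t, ∃ t', t ≤ t' ∧ ρ.proc t' = i}

/-- At most `f` processes crash, and every message in transit to a correct process is eventually
received; there is no bound on the delay or on the relative speed of the processes. -/
structure Admissible (ρ : P.Run x) (f : ℕ) : Prop where
  faults : ρ.correctᶜ.ncard ≤ f
  delivery : ∀ i ∈ ρ.correct, ∀ t m, (i, m) ∈ (ρ.config t).buffer →
    ∃ t', t ≤ t' ∧ ρ.proc t' = i ∧ ρ.recv t' = some m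

/-- Process `i` decides on the output `y` in the run. -/
def Decides (ρ : P.Run x) (i : Fin n) (y : X) : Prop :=
  ∃ t, P.decision ((ρ.config t).state i) = some y

end Run

/-- The protocol solves `ε`-bounded lattice agreement over `(X, δ)` in the asynchronous system
with at most `f` crash faults: for all inputs and all admissible runs, every correct process
decides, and the outputs of the correct processes meet the requirements. -/
def Solves [SemilatticeSup X] (P : Protocol.{u, v} n X) (δ : QuasiMetric X) (f : ℕ)
    (ε : ℝ≥0) : Prop :=
  ∀ (x : Fin n → X) (ρ : P.Run x), ρ.Admissible f →
    ∃ y : Fin n → X, (∀ i ∈ ρ.correct, ρ.Decides i (y i)) ∧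
      IsBoundedLatticeAgreement δ ε ρ.correct x y

end Protocol

/-! A chain `a < b` with distance above `ε` suffices, and validity replaces any bivalence argument.
If all inputs are `a` and `p` is silent, the lower and upper bounds force another process `q` to
decide `a` by some time `T`. Give `p` the input `b` instead and delay it until `T`: `q` sees no
difference and irrevocably decides `a`. Once awake, `p` is correct and must output `b`, its input
and also the join of all inputs, so `tight` fails (`not_solves_of_lt`). Both scenarios must be
admissible infinite runs. First-in first-out delivery provides them for any schedule with few enough
crashes (`fifoRun_admissible`), and `fifo_congr` gives the indistinguishability. -/

namespace QuasiMetric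

open Classical in
/-- The quasi-metric in which any two distinct comparable elements have distance `d`. -/
noncomputable def uniform (X : Type w) [SemilatticeSup X] (d : ℝ≥0) (hd : 0 < d) :
    QuasiMetric X where
  dist a b := if a = b then 0 else if a ≤ b then boundValue d else ⊥
  eq_iff a b := by
    have h0 : boundValue d ≠ 0 := by
      unfold boundValue
      exact_mod_cast hd.ne'
    split_ifs with h h' <;> simp [h, h0]
  le_iff a b := by
    split_ifs with h h'
    · simp [h]
    · simp [h', boundValue]
    · simp [h']
  triangle a b c hab hbc := by
    by_cases h : a = b
    · simp [h]
    by_cases h' : b = c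
    · simp [← h']
    -- Antisymmetry excludes `a = c`, so the remaining case is `d ≤ d + d`.
    have hac : a ≠ c := fun e => h (le_antisymm hab (e ▸ hbc))
    rw [if_neg h, if_neg h', if_neg hac, if_pos hab, if_pos hbc, if_pos (hab.trans hbc)]
    unfold boundValue
    exact_mod_cast le_self_add

theorem uniform_dist_of_lt {X : Type w} [SemilatticeSup X] {d : ℝ≥0} (hd : 0 < d) {a b : X}
    (h : a < b) : (uniform X d hd).dist a b = boundValue d := by
  simp [uniform, h.ne, h.le]

end QuasiMetric

theorem boundValue_lt_boundValue {a b : ℝ≥0} (h : a < b) : boundValue a < boundValue b := by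
  unfold boundValue
  exact_mod_cast h

/-- A sequence that visits every element of a nonempty countable type infinitely often. -/
theorem exists_seq_forall_frequently_eq (α : Type*) [Nonempty α] [Countable α] :
    ∃ σ : ℕ → α, ∀ a t, ∃ t', t ≤ t' ∧ σ t' = a := by
  obtain ⟨g, hg⟩ := exists_surjective_nat α
  refine ⟨fun t => g t.unpair.1, fun a t => ?_⟩
  obtain ⟨k, rfl⟩ := hg a
  exact ⟨Nat.pair k t, Nat.right_le_pair k t, by simp⟩

/-! ### First-in first-out runs -/

namespace Protocol

variable {n : ℕ} {X : Type w} (P : Protocol.{u, v} n X)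

/-- The oldest message to process `i` in the list `L` of messages in transit. -/
def oldest (i : Fin n) (L : List (Fin n × P.Msg)) : Option P.Msg :=
  (L.find? (fun e => e.1 = i)).map Prod.snd

/-- Process `i` takes a step in which it receives the oldest message to it, if there is one. -/
noncomputable def fifoStep (i : Fin n) (c : (Fin n → P.State) × List (Fin n × P.Msg)) :
    (Fin n → P.State) × List (Fin n × P.Msg) :=
  (Function.update c.1 i (P.step i (c.1 i) (P.oldest i c.2)).1,
    c.2.eraseP (fun e => e.1 = i) ++ (P.step i (c.1 i) (P.oldest i c.2)).2.toList)

/-- The states and the list of messages in transit (oldest first) when the processes take steps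
in the order given by `σ`, each time receiving the oldest message to them. -/
noncomputable def fifo (x : Fin n → X) (σ : ℕ → Fin n) :
    ℕ → (Fin n → P.State) × List (Fin n × P.Msg)
  | 0 => (fun i => P.init i (x i), [])
  | t + 1 => P.fifoStep (σ t) (fifo x σ t)

/-- This is the splitting of the buffer that `Step` demands, so that the list dynamics is a genuine
run. -/
theorem coe_eq_consumed_add_eraseP (i : Fin n) (L : List (Fin n × P.Msg)) :
    (L : Multiset (Fin n × P.Msg)) =
      P.consumed i (P.oldest i L) + (L.eraseP (fun e => e.1 = i) : List _) := by
  induction L with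
  | nil => rfl
  | cons e L ih =>
    by_cases h : e.1 = i
    · subst h
      simp [oldest, consumed]
    · have ho : P.oldest i (e :: L) = P.oldest i L := by simp [oldest, h]
      rw [ho, List.eraseP_cons_of_neg (by simpa using h), ← Multiset.cons_coe, ← Multiset.cons_coe,
        Multiset.add_cons, ← ih]

/-- The run with schedule `σ` in which messages are received in first-in first-out order. -/
noncomputable def fifoRun (x : Fin n → X) (σ : ℕ → Fin n) : P.Run x where
  config t := ⟨(P.fifo x σ t).1, ((P.fifo x σ t).2 : List _)⟩
  proc := σ
  recv t := P.oldest (σ t) (P.fifo x σ t).2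
  init_state _ := rfl
  init_buffer := rfl
  step t := by
    refine ⟨rfl, _, P.coe_eq_consumed_add_eraseP (σ t) (P.fifo x σ t).2, ?_⟩
    simp only [fifo, fifoStep, ← Multiset.coe_add, Multiset.coe_toList]

/-- The messages in transit to process `i`, oldest first. -/
def queue (i : Fin n) (L : List (Fin n × P.Msg)) : List P.Msg :=
  (L.filter (fun e => e.1 = i)).map Prod.snd

theorem oldest_eq_head?_queue (i : Fin n) (L : List (Fin n × P.Msg)) :
    P.oldest i L = (P.queue i L).head? := by
  simp [oldest, queue, List.head?_filter]

theorem queue_eraseP_self (i : Fin n) (L : List (Fin n × P.Msg)) :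
    P.queue i (L.eraseP (fun e => e.1 = i)) = (P.queue i L).tail := by
  induction L with
  | nil => rfl
  | cons e L ih =>
    by_cases h : e.1 = i
    · simp [queue, h]
    · rw [List.eraseP_cons_of_neg (by simpa using h)]
      simpa [queue, h] using ih

theorem queue_eraseP_of_ne {i j : Fin n} (hij : i ≠ j) (L : List (Fin n × P.Msg)) :
    P.queue i (L.eraseP (fun e => e.1 = j)) = P.queue i L := by
  induction L with
  | nil => rfl
  | cons e L ih =>
    by_cases h : e.1 = j
    · simp [queue, h, hij.symm]
    · rw [List.eraseP_cons_of_neg (by simpa using h)]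
      by_cases h' : e.1 = i
      · simpa [queue, h'] using ih
      · simpa [queue, h'] using ih

theorem queue_append (i : Fin n) (L L' : List (Fin n × P.Msg)) :
    P.queue i (L ++ L') = P.queue i L ++ P.queue i L' := by
  simp [queue]

theorem mem_queue {i : Fin n} {L : List (Fin n × P.Msg)} {m : P.Msg} :
    m ∈ P.queue i L ↔ (i, m) ∈ L := by
  simp [queue]

theorem queue_fifo_succ_self (x : Fin n → X) (σ : ℕ → Fin n) (t : ℕ) :
    ∃ L, P.queue (σ t) (P.fifo x σ (t + 1)).2 = (P.queue (σ t) (P.fifo x σ t).2).tail ++ L := by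
  simp only [fifo, fifoStep, queue_append, queue_eraseP_self]
  exact ⟨_, rfl⟩

theorem queue_fifo_succ_of_ne (x : Fin n → X) (σ : ℕ → Fin n) {t : ℕ} {i : Fin n} (h : σ t ≠ i) :
    ∃ L, P.queue i (P.fifo x σ (t + 1)).2 = P.queue i (P.fifo x σ t).2 ++ L := by
  simp only [fifo, fifoStep, queue_append, P.queue_eraseP_of_ne h.symm]
  exact ⟨_, rfl⟩

/-- A message keeps its place in the queue to process `i` until the next step of `i`. -/
theorem exists_step_of_queue (x : Fin n → X) (σ : ℕ → Fin n) {i : Fin n} {m : P.Msg} {k : ℕ}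
    (s t : ℕ) (hs : σ (t + s) = i) (h : (P.queue i (P.fifo x σ t).2)[k]? = some m) :
    ∃ t', t ≤ t' ∧ σ t' = i ∧ (P.queue i (P.fifo x σ t').2)[k]? = some m := by
  induction s generalizing t with
  | zero => exact ⟨t, le_rfl, hs, h⟩
  | succ s ih =>
    by_cases hi : σ t = i
    · exact ⟨t, le_rfl, hi, h⟩
    obtain ⟨L, hL⟩ := P.queue_fifo_succ_of_ne x σ hi
    obtain ⟨t', ht', h'⟩ := ih (t + 1) (by rwa [add_right_comm, add_assoc]) (by
      rw [hL, List.getElem?_append_left (List.getElem?_eq_some_iff.1 h).1, h])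
    exact ⟨t', by omega, h'⟩

/-- Induction on the position `k`: each step of `i` removes the head of its queue and new messages
only join at the end, so the message advances by one place per step of `i`. -/
theorem exists_receive_of_queue (x : Fin n → X) (σ : ℕ → Fin n) {i : Fin n} {m : P.Msg}
    (hi : ∀ t, ∃ t', t ≤ t' ∧ σ t' = i) (k t : ℕ)
    (h : (P.queue i (P.fifo x σ t).2)[k]? = some m) :
    ∃ t', t ≤ t' ∧ σ t' = i ∧ P.oldest (σ t') (P.fifo x σ t').2 = some m := by
  induction k generalizing t with
  | zero =>
    obtain ⟨t₀, ht₀, h₀⟩ := hi t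
    obtain ⟨s, rfl⟩ := Nat.exists_eq_add_of_le ht₀
    obtain ⟨t', ht', rfl, h'⟩ := P.exists_step_of_queue x σ s t h₀ h
    exact ⟨t', ht', rfl, by rw [oldest_eq_head?_queue, List.head?_eq_getElem?, h']⟩
  | succ k ih =>
    obtain ⟨t₀, ht₀, h₀⟩ := hi t
    obtain ⟨s, rfl⟩ := Nat.exists_eq_add_of_le ht₀
    obtain ⟨t₁, ht₁, rfl, h₁⟩ := P.exists_step_of_queue x σ s t h₀ h
    obtain ⟨L, hL⟩ := P.queue_fifo_succ_self x σ t₁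
    rw [← List.getElem?_tail] at h₁
    obtain ⟨t', ht', h'⟩ := ih (t₁ + 1) (by
      rw [hL, List.getElem?_append_left (List.getElem?_eq_some_iff.1 h₁).1, h₁])
    exact ⟨t', by omega, h'⟩

theorem fifoRun_admissible (x : Fin n → X) (σ : ℕ → Fin n) {f : ℕ}
    (hf : (P.fifoRun x σ).correctᶜ.ncard ≤ f) : (P.fifoRun x σ).Admissible f where
  faults := hf
  delivery i hi t m hm := by
    obtain ⟨k, hk⟩ := List.mem_iff_getElem?.1 (P.mem_queue.2 (Multiset.mem_coe.1 hm))
    exact P.exists_receive_of_queue x σ hi k t hk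

/-- Two runs with the same schedule up to time `T` are indistinguishable up to `T` if the inputs
differ only at a process that takes no step. -/
theorem fifo_congr {x x' : Fin n → X} {σ σ' : ℕ → Fin n} {p : Fin n} {T : ℕ}
    (hx : ∀ i, i ≠ p → x i = x' i) (hσ : ∀ t < T, σ t = σ' t) (hp : ∀ t < T, σ t ≠ p) :
    ∀ t ≤ T, (∀ i, i ≠ p → (P.fifo x σ t).1 i = (P.fifo x' σ' t).1 i) ∧
      (P.fifo x σ t).2 = (P.fifo x' σ' t).2 := by
  intro t
  induction t with
  | zero => exact fun _ => ⟨fun i hi => by simp [fifo, hx i hi], rfl⟩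
  | succ t ih =>
    intro ht
    obtain ⟨h₁, h₂⟩ := ih (by omega)
    have hs := h₁ _ (hp t ht)
    simp only [fifo, fifoStep, ← hσ t ht, ← h₂, ← hs, and_true]
    intro i hi
    by_cases h : i = σ t
    · subst h
      simp
    · simp [h, h₁ i hi]

variable {P} in
theorem Run.decision_mono {x : Fin n → X} (ρ : P.Run x) {i : Fin n} {y : X} {t t' : ℕ}
    (h : t ≤ t') (hd : P.decision ((ρ.config t).state i) = some y) :
    P.decision ((ρ.config t').state i) = some y := by
  induction t', h using Nat.le_induction with
  | base => exact hd
  | succ t' _ ih =>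
    rw [(ρ.step t').1]
    by_cases h : i = ρ.proc t'
    · subst h
      simpa using P.decision_stable _ _ _ _ ih
    · simpa [h] using ih

variable {P} in
theorem Run.Decides.unique {x : Fin n → X} {ρ : P.Run x} {i : Fin n} {y y' : X}
    (h : ρ.Decides i y) (h' : ρ.Decides i y') : y = y' := by
  obtain ⟨t, ht⟩ := h
  obtain ⟨t', ht'⟩ := h'
  have h₁ := ρ.decision_mono (le_max_left t t') ht
  have h₂ := ρ.decision_mono (le_max_right t t') ht'
  exact Option.some.inj (h₁.symm.trans h₂)

/-- If `a < b` are at distance more than `ε`, then no protocol tolerates one fault: a process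
with input `b` may be so slow that another one decides on `a` before it takes a step. -/
theorem not_solves_of_lt [SemilatticeSup X] {f : ℕ} (hf : 1 ≤ f) {ε : ℝ≥0} {δ : QuasiMetric X}
    {p q : Fin n} (hpq : q ≠ p) {a b : X} (hab : a < b)
    (hδ : boundValue ε < δ.dist a b) : ¬ P.Solves δ f ε := by
  intro hP
  have : Nonempty {i // i ≠ p} := ⟨⟨q, hpq⟩⟩
  have : Nonempty (Fin n) := ⟨p⟩
  -- `τ` is fair to all processes but `p`, and `κ` to all processes; the second run follows `τ`
  -- before `T` and `κ` afterwards.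
  obtain ⟨τ, hτ⟩ := exists_seq_forall_frequently_eq {i // i ≠ p}
  obtain ⟨κ, hκ⟩ := exists_seq_forall_frequently_eq (Fin n)
  -- process `p` takes no step, and all inputs are `a`
  have hc : ∀ i, i ≠ p → i ∈ (P.fifoRun (fun _ => a) (fun t => (τ t : Fin n))).correct := by
    intro i hi t
    obtain ⟨t', ht', h⟩ := hτ ⟨i, hi⟩ t
    exact ⟨t', ht', congrArg Subtype.val h⟩
  obtain ⟨y, hy, hA⟩ := hP _ _ (P.fifoRun_admissible (fun _ => a) (fun t => (τ t : Fin n)) (by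
    refine le_trans ?_ hf
    rw [← Set.ncard_singleton p]
    refine Set.ncard_le_ncard (fun i hi => ?_) (Set.finite_singleton p)
    by_contra hip
    exact hi (hc i hip)))
  have hya : y q = a :=
    le_antisymm ((hA.upward q (hc q hpq)).trans (Finset.sup'_le _ _ fun _ _ => le_rfl))
      (hA.downward q (hc q hpq))
  obtain ⟨T, hT⟩ := hy q (hc q hpq)
  rw [hya] at hT
  -- process `p` has input `b` and wakes up at time `T`
  let x : Fin n → X := Function.update (fun _ => a) p b
  let σ : ℕ → Fin n := fun t => if t < T then τ t else κ t
  -- Nobody crashes in this run: `p` is merely slow, so the requirements bind both `p` and `q`.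
  have hc' : ∀ i, i ∈ (P.fifoRun x σ).correct := by
    intro i t
    obtain ⟨t', ht', h⟩ := hκ i (max t T)
    refine ⟨t', (le_max_left _ _).trans ht', ?_⟩
    have : ¬ t' < T := not_lt.2 ((le_max_right _ _).trans ht')
    simp [fifoRun, σ, this, h]
  obtain ⟨z, hz, hB⟩ := hP x _ (P.fifoRun_admissible x σ (by
    rw [Set.eq_univ_of_forall hc']
    simp))
  have hbp : b ≤ z p := by simpa [x] using hB.downward p (hc' p)
  have hzb : ∀ i, z i ≤ b := fun i => (hB.upward i (hc' i)).trans <| by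
    refine Finset.sup'_le _ _ fun j _ => ?_
    by_cases h : j = p
    · simp [x, h]
    · simp [x, h, hab.le]
  have hzq : z q = a := by
    refine (hz q (hc' q)).unique ⟨T, ?_⟩
    have := (P.fifo_congr (x := fun _ => a) (x' := x) (σ := fun t => (τ t : Fin n)) (σ' := σ)
      (p := p) (T := T) (fun i hi => by simp [x, hi]) (fun t ht => by simp [σ, ht])
      (fun t _ => (τ t).2) T le_rfl).1 q hpq
    change P.decision ((P.fifo x σ T).1 q) = some a
    rw [← this]
    exact hT
  have hzp : z p = b := le_antisymm (hzb p) hbp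
  have := hB.tight q (hc' q) p (hc' p) (by rw [hzq, hzp]; exact hab.le)
  rw [hzq, hzp] at this
  exact not_lt_of_ge this hδ

end Protocol

theorem mainTheorem3 (n f : ℕ) (hn : 2 ≤ n) (hf : 1 ≤ f) (ε : ℝ≥0) :
    (¬ ∃ P : ∀ (X : Type) [SemilatticeSup X] (_ : QuasiMetric X), Protocol.{u, v} n X,
      ∀ (X : Type) [SemilatticeSup X] (δ : QuasiMetric X), (P X δ).Solves δ f ε) ∧
    (∃ (X : Type) (_ : SemilatticeSup X) (_ : Finite X) (δ : QuasiMetric X) (x : Fin n → X),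
      (∃ i j, x i ≠ x j) ∧
      (∀ a ∈ supClosure (Set.range x), ∀ b ∈ supClosure (Set.range x),
        a < b → boundValue ε < δ.dist a b) ∧
      ∀ P : Protocol.{u, v} n X, ¬ P.Solves δ f ε) := by
  -- The distance `ε + 1` exceeds `ε` and is positive even when `ε = 0`.
  have hd : 0 < ε + 1 := by positivity
  let p : Fin n := ⟨0, by omega⟩
  let q : Fin n := ⟨1, by omega⟩
  have hpq : q ≠ p := by simp [p, q]
  have hδ : ∀ a b : Bool, a < b →
      boundValue ε < (QuasiMetric.uniform Bool (ε + 1) hd).dist a b := by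
    intro a b h
    rw [QuasiMetric.uniform_dist_of_lt hd h]
    exact boundValue_lt_boundValue (lt_add_one ε)
  have hP : ∀ P : Protocol.{u, v} n Bool,
      ¬ P.Solves (QuasiMetric.uniform Bool (ε + 1) hd) f ε := fun P =>
    P.not_solves_of_lt hf hpq Bool.false_lt_true (hδ _ _ Bool.false_lt_true)
  refine ⟨fun ⟨P, h⟩ => hP _ (h Bool (QuasiMetric.uniform Bool (ε + 1) hd)), Bool, inferInstance,
    inferInstance, QuasiMetric.uniform Bool (ε + 1) hd, Function.update (fun _ => false) p true,
    ⟨p, q, by simp [hpq]⟩, fun a _ b _ => hδ a b, hP⟩
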